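/- For integers $n \ge r \ge 1$ and a real $b \ge 0$ let $$\mathbb{K}(n,r,b)=\{U\in\mathbb{R}^{n\times r}: U^\top U=I_r,\ \|U\|_{2,\infty}\le b\},\qquad \|U\|_{2,\infty}=\max_{1\le i\le n}\|U_{i,\cdot}\|_2,$$ and let $d_{2,\infty}(U,V)=\min_{\Gamma\in\mathbb{O}_r}\|V-U\Gamma\|_{2,\infty}$, where $\mathbb{O}_r$ is the group of $r\times r$ orthogonal matrices. For a set $K$ with a semi-metric $\rho$ and $\delta>0$, let $\mathcal{M}(K,\rho,\delta)$ be the $\delta$-packing number, that is, the largest cardinality of a subset of $K$ any two distinct points $x,y$ of which satisfy $\rho(x,y)>\delta$. There are universal constants $c_0>0$, $c>0$ and $N\in\mathbb{N}$ such that the following holds for all integers $n\ge N$ and $1\le r\le n$ and all real $\mu$ and $\delta>0$. If $$\frac{n}{\mu}\ge\max\{4,r\},\qquad \mu\ge 12\log(12n),\qquad \frac{c_0^2\,r}{8e^2 n}\le\delta^2\le\frac{c_0^2\,\mu r}{96e^2\, n\log(12n/\mu)},$$ then $$\log\mathcal{M}\bigl(\mathbb{K}(n,r,\sqrt{\mu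 r/n}),\,d_{2,\infty},\,\delta\bigr)\ \ge\ c\,\frac{r^2}{\delta^2}.$$ -/

import Mathlib

noncomputable section

/-- The norm `‖M‖_{2,∞}`: the largest Euclidean norm of a row of `M`. -/
def twoInftyNorm {n r : ℕ} (M : Matrix (Fin n) (Fin r) ℝ) : ℝ :=
  ⨆ i : Fin n, ‖(WithLp.toLp 2 (M i) : EuclideanSpace ℝ (Fin r))‖

/-- The distance `d_{2,∞}(U, V) = min_Γ ‖V - U Γ‖_{2,∞}`, where `Γ` ranges over the (compact)
group of `r × r` orthogonal matrices. -/
def dTwoInfty {n r : ℕ} (U V : Matrix (Fin n) (Fin r) ℝ) : ℝ :=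
  ⨅ Γ : Matrix.orthogonalGroup (Fin r) ℝ, twoInftyNorm (V - U * (Γ : Matrix (Fin r) (Fin r) ℝ))

/-- The set `K(n, r, b)` of `n × r` matrices with orthonormal columns and rows of Euclidean norm
at most `b`. -/
def incoherentFrames (n r : ℕ) (b : ℝ) : Set (Matrix (Fin n) (Fin r) ℝ) :=
  {U | U.transpose * U = 1 ∧ twoInftyNorm U ≤ b}

/-- `P` is a `δ`-packing of `K` under `ρ`: a subset of `K` whose distinct points are at
distance greater than `δ`. -/
def IsPacking {X : Type*} (K : Set X) (ρ : X → X → ℝ) (δ : ℝ) (P : Set X) : Prop :=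
  P ⊆ K ∧ P.Pairwise fun x y => δ < ρ x y

/-- The `δ`-packing number `M(K, ρ, δ)`: the largest cardinality of a `δ`-packing of `K`
(infinite if there are arbitrarily large ones). -/
def packingNumber {X : Type*} (K : Set X) (ρ : X → X → ℝ) (δ : ℝ) : ℕ∞ :=
  ⨆ P : {P : Set X // IsPacking K ρ δ P}, P.1.encard

/-- The packing `δ`-entropy `log M(K, ρ, δ)`, with values in the extended reals. -/
def packingEntropy {X : Type*} (K : Set X) (ρ : X → X → ℝ) (δ : ℝ) : EReal :=
  ENNReal.log (packingNumber K ρ δ : ENNReal)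

end

/-!
In `ℝ^(2 r)` there is always an `r`-dimensional space orthogonal to the fewer than `r` vectors
chosen so far, and the `2 ^ r` normalized sign combinations `u_ε` of a basis of it are spread out:
`∑ ε, exp (-r ‖v - u_ε‖²) ≤ exp (3 r / 8)` for every `v`. Choosing the vectors of a frame one
after the other in this way gives `2 ^ (r²)` orthonormal `r`-frames whose exponential moment
around any family of `r` vectors is at most `exp (3 r² / 8)`. Moments multiply over `q`-tuples of
frames, so few tuples lie near a given one, and a maximal separated set of tuples has at least
`exp (q r² / 8)` elements.

Stacking `q` copies of a fixed frame on top of a tuple and rescaling gives an `n × r` frame with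
rows of norm at most `1 / √(2 q)`. A rotation `Γ` moves all orthonormal frames by the same amount:
if it moves the copies a lot, the two matrices differ there, and if not, it does not help to align
the rest. Hence separated tuples give matrices that are separated in `d_{2,∞}`, and the choice
`q ≈ 1 / (256 δ²)` makes the separation exceed `δ`.
-/

open Real (exp)

section Packing

variable {X Y : Type*} {K : Set Y} {ρ : Y → Y → ℝ} {δ : ℝ}

theorem exists_isPacking_forall_exists_le (hK : K.Finite) (hsymm : ∀ x y, ρ x y = ρ y x)
    (hself : ∀ y, ρ y y ≤ δ) :
    ∃ S : Finset Y, IsPacking K ρ δ S ∧ ∀ y ∈ K, ∃ x ∈ S, ρ x y ≤ δ := by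
  have hfin : {P | IsPacking K ρ δ P}.Finite := hK.finite_subsets.subset fun P hP => hP.1
  obtain ⟨P, hP, hmax⟩ := hfin.exists_maximal ⟨∅, Set.empty_subset K, Set.pairwise_empty _⟩
  lift P to Finset Y using hK.subset hP.1
  refine ⟨P, hP, fun y hy => ?_⟩
  by_contra! hfar
  have hinsert : IsPacking K ρ δ (insert y P) :=
    ⟨Set.insert_subset hy hP.1,
      hP.2.insert fun x hx _ => ⟨hsymm x y ▸ hfar x hx, hfar x hx⟩⟩
  exact (hself y).not_gt (hfar y (hmax hinsert (Set.subset_insert y _) (Set.mem_insert y _)))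

theorem card_filter_le_exp_mul_sum_exp_neg [Fintype X] (f : X → ℝ) (R : ℝ) :
    ((Finset.univ.filter fun x => f x ≤ R).card : ℝ) ≤ exp R * ∑ x, exp (-f x) := by
  rw [Finset.card_filter, Nat.cast_sum, Finset.mul_sum]
  refine Finset.sum_le_sum fun x _ => ?_
  rw [← Real.exp_add]
  split_ifs with hx
  · simpa using hx
  · simpa using (Real.exp_pos _).le

theorem exists_isPacking_range_card_le [Fintype X] (f : X → Y) (hsymm : ∀ x y, ρ x y = ρ y x)
    (hself : ∀ y, ρ y y ≤ δ) {Λ : ℝ} (hsum : ∀ y, ∑ x, exp (-ρ y (f x)) ≤ Λ) :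
    ∃ S : Finset Y, IsPacking (Set.range f) ρ δ S ∧
      (Fintype.card X : ℝ) ≤ S.card * (exp δ * Λ) := by
  classical
  obtain ⟨S, hS, hnet⟩ := exists_isPacking_forall_exists_le (Set.finite_range f) hsymm hself
  refine ⟨S, hS, ?_⟩
  have hcover : Finset.univ ⊆ S.biUnion fun y => Finset.univ.filter fun x => ρ y (f x) ≤ δ :=
    fun x _ => by simpa using hnet (f x) (Set.mem_range_self x)
  calc (Fintype.card X : ℝ)
      ≤ ∑ y ∈ S, ((Finset.univ.filter fun x => ρ y (f x) ≤ δ).card : ℝ) := by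
        exact_mod_cast (Finset.card_le_card hcover).trans Finset.card_biUnion_le
    _ ≤ ∑ _y ∈ S, exp δ * Λ := by
        exact Finset.sum_le_sum fun y _ => (card_filter_le_exp_mul_sum_exp_neg _ δ).trans
          (mul_le_mul_of_nonneg_left (hsum y) (Real.exp_pos δ).le)
    _ = S.card * (exp δ * Λ) := by rw [Finset.sum_const, nsmul_eq_mul]

theorem encard_le_packingNumber {S : Set X} {f : X → Y} (hK : Set.MapsTo f S K)
    (hself : ∀ y ∈ K, ρ y y ≤ δ) (hS : S.Pairwise fun x y => δ < ρ (f x) (f y)) :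
    S.encard ≤ packingNumber K ρ δ := by
  have hinj : Set.InjOn f S := fun x hx y hy hxy => by
    by_contra hne
    exact (hself _ (hK hy)).not_gt (by simpa only [hxy] using hS hx hy hne)
  have hpacking : IsPacking K ρ δ (f '' S) := ⟨hK.image_subset, hinj.pairwise_image.2 hS⟩
  rw [← hinj.encard_image]
  exact le_iSup (fun P : {P : Set Y // IsPacking K ρ δ P} => P.1.encard) ⟨_, hpacking⟩

theorem le_packingEntropy {a : ℝ} {k : ℕ} (ha : exp a ≤ k) (hk : k ≤ packingNumber K ρ δ) :
    (a : EReal) ≤ packingEntropy K ρ δ := by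
  have hle : ENNReal.ofReal (exp a) ≤ (packingNumber K ρ δ : ENNReal) :=
    calc ENNReal.ofReal (exp a) ≤ ENNReal.ofReal k := ENNReal.ofReal_le_ofReal ha
      _ = ((k : ℕ∞) : ENNReal) := by rw [ENNReal.ofReal_natCast, ENat.toENNReal_coe]
      _ ≤ packingNumber K ρ δ := ENat.toENNReal_le.2 hk
  calc (a : EReal) = ENNReal.log (ENNReal.ofReal (exp a)) := by
        rw [ENNReal.log_ofReal_of_pos (Real.exp_pos _), Real.log_exp]
    _ ≤ packingEntropy K ρ δ := ENNReal.log_monotone hle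

end Packing

section SignSum

theorem sum_pi_exp_neg_sum_le_pow {ι α : Type*} [Fintype ι] [DecidableEq ι] [Fintype α]
    {f : ι → α → ℝ} {C : ℝ} (hf : ∀ i, ∑ a, exp (-f i a) ≤ C) :
    ∑ x : ι → α, exp (-∑ i, f i (x i)) ≤ C ^ Fintype.card ι := by
  simp_rw [← Finset.sum_neg_distrib, Real.exp_sum]
  rw [← Fintype.prod_sum fun i a => exp (-f i a)]
  calc ∏ i, ∑ a, exp (-f i a) ≤ ∏ _i : ι, C :=
        Finset.prod_le_prod (fun _ _ => Finset.sum_nonneg fun _ _ => (Real.exp_pos _).le)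
          fun i _ => hf i
    _ = C ^ Fintype.card ι := Finset.prod_const C

-- Any constant below `log 2` in place of `3 / 8` would give exponentially large packings.
theorem sum_units_int_exp_neg_sub_sq_le (t : ℝ) :
    ∑ ε : ℤˣ, exp (-(t - (ε : ℤ)) ^ 2) ≤ exp (3 / 8) := by
  have hexp_neg_one : exp (-1) ≤ 3 / 8 := by
    rw [Real.exp_neg, inv_le_comm₀ (Real.exp_pos _) (by norm_num)]
    linarith [Real.exp_one_gt_d9]
  have hpair : exp (-(t - 1) ^ 2) + exp (-(t + 1) ^ 2) ≤ 1 + exp (-1) := by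
    rcases le_total 0 t with ht | ht
    · have hnear : exp (-(t - 1) ^ 2) ≤ 1 := Real.exp_le_one_iff.2 (by nlinarith)
      have hfar : exp (-(t + 1) ^ 2) ≤ exp (-1) := Real.exp_le_exp.2 (by nlinarith)
      linarith
    · have hnear : exp (-(t + 1) ^ 2) ≤ 1 := Real.exp_le_one_iff.2 (by nlinarith)
      have hfar : exp (-(t - 1) ^ 2) ≤ exp (-1) := Real.exp_le_exp.2 (by nlinarith)
      linarith
  calc ∑ ε : ℤˣ, exp (-(t - (ε : ℤ)) ^ 2) = exp (-(t - 1) ^ 2) + exp (-(t + 1) ^ 2) := by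
        simp [UnitsInt.univ]
    _ ≤ 3 / 8 + 1 := by linarith
    _ ≤ exp (3 / 8) := Real.add_one_le_exp _

variable {E κ : Type*} [NormedAddCommGroup E] [InnerProductSpace ℝ E] [Fintype κ]

/-- The signed combination `|κ|^{-1/2} ∑ k, ε k • b k` of a family of vectors; for orthonormal `b`
these are `2 ^ |κ|` unit vectors that are spread out around every point. -/
noncomputable def normalizedSignSum (b : κ → E) (ε : κ → ℤˣ) : E :=
  (√(Fintype.card κ : ℝ))⁻¹ • ∑ k, ((ε k : ℤ) : ℝ) • b k

theorem norm_normalizedSignSum [Nonempty κ] {b : κ → E} (hb : Orthonormal ℝ b) (ε : κ → ℤˣ) :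
    ‖normalizedSignSum b ε‖ = 1 := by
  have hsq : ‖∑ k, ((ε k : ℤ) : ℝ) • b k‖ ^ 2 = Fintype.card κ := by
    have hε : ∀ k, ((ε k : ℤ) : ℝ) * (ε k : ℤ) = 1 := fun k => by
      exact_mod_cast Int.units_coe_mul_self (ε k)
    rw [← real_inner_self_eq_norm_sq, hb.inner_sum]
    simp [hε]
  rw [← sq_eq_sq₀ (norm_nonneg _) zero_le_one, normalizedSignSum, norm_smul, mul_pow, hsq]
  simp

theorem sum_exp_neg_norm_sub_normalizedSignSum_le [Nonempty κ] [DecidableEq κ] {b : κ → E}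
    (hb : Orthonormal ℝ b) (v : E) :
    ∑ ε : κ → ℤˣ, exp (-(Fintype.card κ * ‖v - normalizedSignSum b ε‖ ^ 2)) ≤
      exp (3 / 8) ^ Fintype.card κ := by
  set D : ℝ := (Fintype.card κ : ℝ)
  have hD : 0 < D := by positivity
  have hbessel : ∀ ε : κ → ℤˣ, ∑ k, (inner ℝ (b k) (√D • v) - (ε k : ℤ)) ^ 2 ≤
      D * ‖v - normalizedSignSum b ε‖ ^ 2 := fun ε => by
    set x := √D • v - ∑ k, ((ε k : ℤ) : ℝ) • b k with hx
    have hscale : x = √D • (v - normalizedSignSum b ε) := by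
      rw [hx, smul_sub, normalizedSignSum, smul_inv_smul₀ (Real.sqrt_pos.2 hD).ne']
    calc ∑ k, (inner ℝ (b k) (√D • v) - (ε k : ℤ)) ^ 2 = ∑ k, ‖inner ℝ (b k) x‖ ^ 2 := by
          simp only [hx, inner_sub_right, hb.inner_right_fintype, Real.norm_eq_abs, sq_abs]
      _ ≤ ‖x‖ ^ 2 := hb.sum_inner_products_le x
      _ = D * ‖v - normalizedSignSum b ε‖ ^ 2 := by
          rw [hscale, norm_smul, mul_pow, Real.norm_of_nonneg (Real.sqrt_nonneg _),
            Real.sq_sqrt hD.le]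
  calc ∑ ε : κ → ℤˣ, exp (-(D * ‖v - normalizedSignSum b ε‖ ^ 2))
      ≤ ∑ ε : κ → ℤˣ, exp (-∑ k, (inner ℝ (b k) (√D • v) - (ε k : ℤ)) ^ 2) := by
        gcongr with ε
        exact hbessel ε
    _ ≤ exp (3 / 8) ^ Fintype.card κ :=
        sum_pi_exp_neg_sum_le_pow fun _ => sum_units_int_exp_neg_sub_sq_le _

end SignSum

section Frames

variable {E : Type*} [NormedAddCommGroup E] [InnerProductSpace ℝ E] [FiniteDimensional ℝ E]
  {D r : ℕ}

theorem exists_orthonormal_forall_inner_eq_zero (h : r + D ≤ Module.finrank ℝ E)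
    (u : Fin r → E) : ∃ b : Fin D → E, Orthonormal ℝ b ∧ ∀ k j, inner ℝ (b k) (u j) = 0 := by
  set K := Submodule.span ℝ (Set.range u)
  have hK : Module.finrank ℝ K ≤ r := by
    simpa [Set.finrank] using finrank_range_le_card (R := ℝ) u
  have hD : D ≤ Module.finrank ℝ Kᗮ := by
    have := K.finrank_add_finrank_orthogonal
    omega
  let B := stdOrthonormalBasis ℝ Kᗮ
  refine ⟨fun k => B (Fin.castLE hD k), ?_, fun k j => ?_⟩
  · exact (B.orthonormal.comp_linearIsometry Kᗮ.subtypeₗᵢ).comp _ (Fin.castLE_injective hD)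
  · exact Submodule.inner_left_of_mem_orthogonal (Submodule.subset_span (Set.mem_range_self j))
      (B (Fin.castLE hD k)).2

/-- Greedy construction: each new vector is a sign combination of `D` directions orthogonal to
the previous vectors. -/
theorem exists_orthonormal_sum_exp_neg_le (hD : D ≠ 0) (h : r + D ≤ Module.finrank ℝ E) :
    ∃ u : (Fin r → Fin D → ℤˣ) → Fin r → E, (∀ x, Orthonormal ℝ (u x)) ∧
      ∀ v : Fin r → E, ∑ x, exp (-∑ j, D * ‖v j - u x j‖ ^ 2) ≤ exp (3 / 8) ^ (D * r) := by
  have : NeZero D := ⟨hD⟩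
  induction r with
  | zero => exact ⟨fun _ => Fin.elim0, fun _ => .of_isEmpty _, by simp⟩
  | succ r ih =>
    obtain ⟨u, hu, hsum⟩ := ih (by omega)
    choose b hb hbu using fun x =>
      exists_orthonormal_forall_inner_eq_zero (D := D) (r := r) (by omega) (u x)
    refine ⟨fun x => Matrix.vecCons (normalizedSignSum (b (Fin.tail x)) (x 0)) (u (Fin.tail x)),
      fun x => ?_, fun v => ?_⟩
    · refine orthonormal_vecCons_iff.2 ⟨norm_normalizedSignSum (hb _) _, fun i => ?_, hu _⟩
      simp [normalizedSignSum, inner_smul_left, sum_inner, hbu]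
    · calc _ = ∑ p : (Fin D → ℤˣ) × (Fin r → Fin D → ℤˣ),
              exp (-(D * ‖v 0 - normalizedSignSum (b p.2) p.1‖ ^ 2)) *
                exp (-∑ j : Fin r, D * ‖v j.succ - u p.2 j‖ ^ 2) :=
            Fintype.sum_equiv (Fin.consEquiv _).symm _ _ fun x => by
              rw [← Real.exp_add, ← neg_add, Fin.sum_univ_succ]
              rfl
        _ ≤ ∑ y, exp (3 / 8) ^ D * exp (-∑ j : Fin r, D * ‖v j.succ - u y j‖ ^ 2) := by
            simp_rw [Fintype.sum_prod_type_right, ← Finset.sum_mul]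
            gcongr with y
            simpa using sum_exp_neg_norm_sub_normalizedSignSum_le (hb y) (v 0)
        _ ≤ exp (3 / 8) ^ D * exp (3 / 8) ^ (D * r) := by
            rw [← Finset.mul_sum]
            gcongr
            exact hsum fun j => v j.succ
        _ = exp (3 / 8) ^ (D * (r + 1)) := by ring

theorem exp_div_eight_le_of_two_pow_le {N : ℕ} {m : ℝ}
    (h : 2 ^ N ≤ m * (exp (N / 8) * exp (3 / 8) ^ N)) : exp (N / 8) ≤ m := by
  have htwo : (2 : ℝ) ^ N = exp (N * Real.log 2) := by
    rw [Real.exp_nat_mul, Real.exp_log two_pos]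
  rw [htwo, ← Real.exp_nat_mul, ← Real.exp_add] at h
  refine le_of_mul_le_mul_right (h.trans' ?_) (Real.exp_pos _)
  rw [← Real.exp_add, Real.exp_le_exp]
  nlinarith [Real.log_two_gt_d9, N.cast_nonneg (α := ℝ)]

theorem exists_separated_orthonormal_families (κ : Type*) [Fintype κ] (hD : D ≠ 0)
    (h : r + D ≤ Module.finrank ℝ E) :
    ∃ S : Finset (κ → Fin r → E), (∀ u ∈ S, ∀ k, Orthonormal ℝ (u k)) ∧
      (S : Set (κ → Fin r → E)).Pairwise
        (fun u v => (r * Fintype.card κ / 8 : ℝ) < ∑ k, ∑ j, ‖u k j - v k j‖ ^ 2) ∧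
      exp ((D * r * Fintype.card κ : ℕ) / 8) ≤ S.card := by
  classical
  obtain ⟨u, hu, hsum⟩ := exists_orthonormal_sum_exp_neg_le (E := E) hD h
  let f : (κ → Fin r → Fin D → ℤˣ) → κ → Fin r → E := fun x k => u (x k)
  let ρ : (κ → Fin r → E) → (κ → Fin r → E) → ℝ :=
    fun v w => ∑ k, ∑ j, D * ‖v k j - w k j‖ ^ 2
  have hρ : ∀ v, ∑ x, exp (-ρ v (f x)) ≤ (exp (3 / 8) ^ (D * r)) ^ Fintype.card κ := fun v =>
    sum_pi_exp_neg_sum_le_pow (f := fun k y => ∑ j, D * ‖v k j - u y j‖ ^ 2) fun k => hsum (v k)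
  obtain ⟨S, hS, hcard⟩ := exists_isPacking_range_card_le
    (δ := ((D * r * Fintype.card κ : ℕ) / 8 : ℝ)) f (fun v w => by simp only [ρ, norm_sub_rev])
    (fun v => by simpa [ρ] using by positivity) hρ
  refine ⟨S, fun v hv k => ?_, fun v hv w hw hvw => ?_, exp_div_eight_le_of_two_pow_le ?_⟩
  · obtain ⟨x, rfl⟩ := hS.1 hv
    exact hu (x k)
  · have hsep := hS.2 hv hw hvw
    simp_rw [ρ, ← Finset.mul_sum] at hsep
    refine lt_of_mul_lt_mul_left (hsep.trans_eq' ?_) (Nat.cast_nonneg D)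
    push_cast
    ring
  · simpa [pow_mul] using hcard

end Frames

section TwoInfty

variable {n r : ℕ}

theorem twoInftyNorm_nonneg (M : Matrix (Fin n) (Fin r) ℝ) : 0 ≤ twoInftyNorm M :=
  Real.iSup_nonneg fun _ => norm_nonneg _

theorem sum_row_sq_le_twoInftyNorm_sq (M : Matrix (Fin n) (Fin r) ℝ) (i : Fin n) :
    ∑ j, M i j ^ 2 ≤ twoInftyNorm M ^ 2 := by
  have hrow : ‖(WithLp.toLp 2 (M i) : EuclideanSpace ℝ (Fin r))‖ ≤ twoInftyNorm M :=
    le_ciSup (f := fun i => ‖(WithLp.toLp 2 (M i) : EuclideanSpace ℝ (Fin r))‖)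
      (Set.finite_range _).bddAbove i
  simpa only [EuclideanSpace.real_norm_sq_eq] using pow_le_pow_left₀ (norm_nonneg _) hrow 2

theorem twoInftyNorm_le {M : Matrix (Fin n) (Fin r) ℝ} {b : ℝ} (hb : 0 ≤ b)
    (hM : ∀ i, ∑ j, M i j ^ 2 ≤ b ^ 2) : twoInftyNorm M ≤ b :=
  Real.iSup_le (fun i => (sq_le_sq₀ (norm_nonneg _) hb).1
    (by simpa only [EuclideanSpace.real_norm_sq_eq] using hM i)) hb

theorem dTwoInfty_self (U : Matrix (Fin n) (Fin r) ℝ) : dTwoInfty U U = 0 := by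
  refine le_antisymm ?_ (Real.iInf_nonneg fun _ => twoInftyNorm_nonneg _)
  have hbdd : BddBelow (Set.range fun Γ : Matrix.orthogonalGroup (Fin r) ℝ =>
      twoInftyNorm (U - U * (Γ : Matrix (Fin r) (Fin r) ℝ))) :=
    ⟨0, Set.forall_mem_range.2 fun _ => twoInftyNorm_nonneg _⟩
  exact (ciInf_le hbdd 1).trans (twoInftyNorm_le le_rfl fun i => by simp)

end TwoInfty

section Anchoring

variable {E ι : Type*} [NormedAddCommGroup E] [InnerProductSpace ℝ E] [Fintype ι] {u u₀ : ι → E}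

theorem sum_norm_sub_sum_smul_sq_of_orthonormal [DecidableEq ι] (hu : Orthonormal ℝ u)
    (A : Matrix ι ι ℝ) :
    ∑ j, ‖u j - ∑ k, A k j • u k‖ ^ 2 = ∑ j, ∑ k, (1 - A) k j ^ 2 := by
  refine Finset.sum_congr rfl fun j _ => ?_
  have hcomb : u j - ∑ k, A k j • u k = ∑ k, (1 - A) k j • u k := by
    simp [sub_smul, Finset.sum_sub_distrib, Matrix.one_apply]
  rw [hcomb, ← real_inner_self_eq_norm_sq, hu.inner_sum]
  simp [sq]

/-- How far a matrix `A` moves an orthonormal family does not depend on the family, so a family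
`u₀` shared by two configurations bounds the effect of `A` on `u`. -/
theorem sum_norm_sub_sq_le_of_orthonormal (hu : Orthonormal ℝ u) (hu₀ : Orthonormal ℝ u₀)
    (v : ι → E) (A : Matrix ι ι ℝ) :
    ∑ j, ‖v j - u j‖ ^ 2 ≤
      2 * (∑ j, ‖u₀ j - ∑ k, A k j • u₀ k‖ ^ 2 + ∑ j, ‖v j - ∑ k, A k j • u k‖ ^ 2) := by
  classical
  rw [sum_norm_sub_sum_smul_sq_of_orthonormal hu₀ A,
    ← sum_norm_sub_sum_smul_sq_of_orthonormal hu A, ← Finset.sum_add_distrib, Finset.mul_sum]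
  refine Finset.sum_le_sum fun j _ => ?_
  calc ‖v j - u j‖ ^ 2
      ≤ (‖v j - ∑ k, A k j • u k‖ + ‖∑ k, A k j • u k - u j‖) ^ 2 := by
        gcongr
        exact norm_sub_le_norm_sub_add_norm_sub _ _ _
    _ ≤ 2 * (‖v j - ∑ k, A k j • u k‖ ^ 2 + ‖∑ k, A k j • u k - u j‖ ^ 2) := add_sq_le
    _ = 2 * (‖u j - ∑ k, A k j • u k‖ ^ 2 + ‖v j - ∑ k, A k j • u k‖ ^ 2) := by
        rw [norm_sub_rev _ (u j), add_comm]

end Anchoring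

section StackedFrame

variable {n r : ℕ} {κ σ : Type*} [Fintype κ]

/-- The `n × r` matrix obtained by stacking the frames `w k`, whose vectors become columns, and
scaling by `|κ|^{-1/2}`; coordinate `a` of frame `k` goes to row `e (k, a)`, and the rows outside
the range of `e` vanish. It turns orthonormal frames into one frame with small rows. -/
noncomputable def stackedFrame (e : κ × σ ↪ Fin n) (w : κ → Fin r → EuclideanSpace ℝ σ) :
    Matrix (Fin n) (Fin r) ℝ :=
  Matrix.of (Function.extend e (fun p j => (√(Fintype.card κ : ℝ))⁻¹ * w p.1 j p.2) 0)

variable {e : κ × σ ↪ Fin n} {w : κ → Fin r → EuclideanSpace ℝ σ}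

theorem stackedFrame_apply (p : κ × σ) (j : Fin r) :
    stackedFrame e w (e p) j = (√(Fintype.card κ : ℝ))⁻¹ * w p.1 j p.2 := by
  simp [stackedFrame, e.injective.extend_apply]

theorem stackedFrame_apply_of_notMem_range {i : Fin n} (hi : i ∉ Set.range e) (j : Fin r) :
    stackedFrame e w i j = 0 := by
  simp [stackedFrame, Function.extend_apply' _ _ _ hi]

theorem stackedFrame_sub_mul (v : κ → Fin r → EuclideanSpace ℝ σ) (A : Matrix (Fin r) (Fin r) ℝ) :
    stackedFrame e v - stackedFrame e w * A =
      stackedFrame e fun k j => v k j - ∑ l, A l j • w k l := by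
  ext i j
  by_cases hi : i ∈ Set.range e
  · obtain ⟨p, rfl⟩ := hi
    simp only [Matrix.sub_apply, Matrix.mul_apply, stackedFrame_apply, PiLp.sub_apply,
      WithLp.ofLp_sum, WithLp.ofLp_smul, Finset.sum_apply, Pi.smul_apply, smul_eq_mul, mul_sub,
      Finset.mul_sum]
    congr 1
    exact Finset.sum_congr rfl fun l _ => by ring
  · simp [Matrix.mul_apply, stackedFrame_apply_of_notMem_range hi]

theorem sum_stackedFrame_row_sq (p : κ × σ) :
    ∑ j, stackedFrame e w (e p) j ^ 2 = (Fintype.card κ : ℝ)⁻¹ * ∑ j, w p.1 j p.2 ^ 2 := by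
  simp only [stackedFrame_apply, mul_pow, inv_pow, Real.sq_sqrt (Nat.cast_nonneg _),
    Finset.mul_sum]

variable [Fintype σ]

theorem transpose_stackedFrame_mul_self [Nonempty κ] (hw : ∀ k, Orthonormal ℝ (w k)) :
    (stackedFrame e w).transpose * stackedFrame e w = 1 := by
  have hgram : ∀ k i j, ∑ a, w k i a * w k j a = (1 : Matrix (Fin r) (Fin r) ℝ) i j :=
    fun k i j => by
      simpa [PiLp.inner_apply, Matrix.one_apply, mul_comm] using orthonormal_iff_ite.1 (hw k) i j
  ext i j
  calc ∑ x, stackedFrame e w x i * stackedFrame e w x j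
      = ∑ p : κ × σ, stackedFrame e w (e p) i * stackedFrame e w (e p) j :=
        (Fintype.sum_of_injective e e.injective _ _
          (fun x hx => by rw [stackedFrame_apply_of_notMem_range hx, zero_mul])
          fun _ => rfl).symm
    _ = (Fintype.card κ : ℝ)⁻¹ * ∑ k, ∑ a, w k i a * w k j a := by
        simp only [stackedFrame_apply, mul_mul_mul_comm, ← sq, inv_pow,
          Real.sq_sqrt (Nat.cast_nonneg _), ← Finset.mul_sum, Fintype.sum_prod_type]
    _ = (1 : Matrix (Fin r) (Fin r) ℝ) i j := by simp [hgram]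

theorem twoInftyNorm_stackedFrame_le (hw : ∀ k, Orthonormal ℝ (w k)) :
    twoInftyNorm (stackedFrame e w) ≤ (√(Fintype.card κ : ℝ))⁻¹ := by
  refine twoInftyNorm_le (by positivity) fun i => ?_
  rw [inv_pow, Real.sq_sqrt (Nat.cast_nonneg _)]
  by_cases hi : i ∈ Set.range e
  · obtain ⟨⟨k, a⟩, rfl⟩ := hi
    have hbessel : ∑ j, w k j a ^ 2 ≤ 1 := by
      classical
      simpa [EuclideanSpace.inner_single_right] using
        (hw k).sum_inner_products_le (s := Finset.univ) (EuclideanSpace.single a (1 : ℝ))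
    rw [sum_stackedFrame_row_sq]
    exact mul_le_of_le_one_right (by positivity) hbessel
  · simp [stackedFrame_apply_of_notMem_range hi]

theorem stackedFrame_mem_incoherentFrames [Nonempty κ] {b : ℝ} (hw : ∀ k, Orthonormal ℝ (w k))
    (hb : (√(Fintype.card κ : ℝ))⁻¹ ≤ b) : stackedFrame e w ∈ incoherentFrames n r b :=
  ⟨transpose_stackedFrame_mul_self hw, (twoInftyNorm_stackedFrame_le hw).trans hb⟩

theorem sum_norm_sq_le_twoInftyNorm_stackedFrame_sq (e : κ × σ ↪ Fin n)
    (w : κ → Fin r → EuclideanSpace ℝ σ) :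
    ∑ k, ∑ j, ‖w k j‖ ^ 2 ≤
      Fintype.card κ ^ 2 * Fintype.card σ * twoInftyNorm (stackedFrame e w) ^ 2 := by
  have hrow : ∀ k a, ∑ j, w k j a ^ 2 ≤ Fintype.card κ * twoInftyNorm (stackedFrame e w) ^ 2 :=
    fun k a => by
      have : Nonempty κ := ⟨k⟩
      rw [← inv_mul_le_iff₀ (by positivity), ← sum_stackedFrame_row_sq (k, a)]
      exact sum_row_sq_le_twoInftyNorm_sq _ _
  calc ∑ k, ∑ j, ‖w k j‖ ^ 2 = ∑ k, ∑ a, ∑ j, w k j a ^ 2 := by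
        simp_rw [EuclideanSpace.real_norm_sq_eq, Finset.sum_comm (γ := σ)]
    _ ≤ ∑ _k : κ, ∑ _a : σ, Fintype.card κ * twoInftyNorm (stackedFrame e w) ^ 2 :=
        Finset.sum_le_sum fun k _ => Finset.sum_le_sum fun a _ => hrow k a
    _ = Fintype.card κ ^ 2 * Fintype.card σ * twoInftyNorm (stackedFrame e w) ^ 2 := by
        simp only [Finset.sum_const, Finset.card_univ, nsmul_eq_mul]
        ring

/-- The stacked frame of `u` together with `|κ|` copies of `u₀`. The copies pin down the rotation
in `dTwoInfty`, which makes the distance between two such matrices control the distance between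
the underlying families. -/
noncomputable def anchoredFrame (e : (κ ⊕ κ) × σ ↪ Fin n) (u₀ : Fin r → EuclideanSpace ℝ σ)
    (u : κ → Fin r → EuclideanSpace ℝ σ) : Matrix (Fin n) (Fin r) ℝ :=
  stackedFrame e (Sum.elim (fun _ => u₀) u)

variable {e : (κ ⊕ κ) × σ ↪ Fin n} {u₀ : Fin r → EuclideanSpace ℝ σ}
  {u v : κ → Fin r → EuclideanSpace ℝ σ}

theorem anchoredFrame_mem_incoherentFrames [Nonempty κ] {b : ℝ} (hu₀ : Orthonormal ℝ u₀)
    (hu : ∀ k, Orthonormal ℝ (u k)) (hb : (√(2 * Fintype.card κ : ℝ))⁻¹ ≤ b) :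
    anchoredFrame e u₀ u ∈ incoherentFrames n r b :=
  stackedFrame_mem_incoherentFrames (Sum.forall.2 ⟨fun _ => hu₀, hu⟩)
    (by simpa [two_mul] using hb)

theorem sum_norm_sub_sq_le_twoInftyNorm_anchoredFrame_sub_mul (hu₀ : Orthonormal ℝ u₀)
    (hu : ∀ k, Orthonormal ℝ (u k)) (A : Matrix (Fin r) (Fin r) ℝ) :
    ∑ k, ∑ j, ‖v k j - u k j‖ ^ 2 ≤ 8 * Fintype.card κ ^ 2 * Fintype.card σ *
      twoInftyNorm (anchoredFrame e u₀ v - anchoredFrame e u₀ u * A) ^ 2 := by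
  calc ∑ k, ∑ j, ‖v k j - u k j‖ ^ 2
      ≤ ∑ k, 2 * (∑ j, ‖u₀ j - ∑ l, A l j • u₀ l‖ ^ 2 +
          ∑ j, ‖v k j - ∑ l, A l j • u k l‖ ^ 2) :=
        Finset.sum_le_sum fun k _ => sum_norm_sub_sq_le_of_orthonormal (hu k) hu₀ (v k) A
    _ = 2 * ∑ k : κ ⊕ κ, ∑ j, ‖(Sum.elim (fun _ => u₀) v k j) -
          ∑ l, A l j • Sum.elim (fun _ => u₀) u k l‖ ^ 2 := by
        rw [← Finset.mul_sum, Finset.sum_add_distrib, Fintype.sum_sum_type]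
        rfl
    _ ≤ 2 * (Fintype.card (κ ⊕ κ) ^ 2 * Fintype.card σ *
          twoInftyNorm (anchoredFrame e u₀ v - anchoredFrame e u₀ u * A) ^ 2) := by
        rw [anchoredFrame, anchoredFrame, stackedFrame_sub_mul]
        gcongr
        exact sum_norm_sq_le_twoInftyNorm_stackedFrame_sq e _
    _ = 8 * Fintype.card κ ^ 2 * Fintype.card σ *
          twoInftyNorm (anchoredFrame e u₀ v - anchoredFrame e u₀ u * A) ^ 2 := by
        rw [Fintype.card_sum]
        push_cast
        ring

theorem sqrt_sum_norm_sub_sq_div_le_dTwoInfty_anchoredFrame (hu₀ : Orthonormal ℝ u₀)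
    (hu : ∀ k, Orthonormal ℝ (u k)) :
    √((∑ k, ∑ j, ‖v k j - u k j‖ ^ 2) / (8 * Fintype.card κ ^ 2 * Fintype.card σ)) ≤
      dTwoInfty (anchoredFrame e u₀ u) (anchoredFrame e u₀ v) :=
  le_ciInf fun _ => Real.sqrt_le_iff.2 ⟨twoInftyNorm_nonneg _,
    div_le_of_le_mul₀ (by positivity) (sq_nonneg _) <| by
      rw [mul_comm]
      exact sum_norm_sub_sq_le_twoInftyNorm_anchoredFrame_sub_mul hu₀ hu _⟩

end StackedFrame

section Entropy

variable {n r : ℕ} {b δ : ℝ}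

theorem mul_sq_div_eight_le_packingEntropy {q : ℕ} (hq : 0 < q) (hr : 0 < r)
    (hn : 4 * q * r ≤ n) (hb : (√(2 * q : ℝ))⁻¹ ≤ b) (hδ₀ : 0 ≤ δ) (hδ : 128 * q * δ ^ 2 < 1) :
    ((q * r ^ 2 / 8 : ℝ) : EReal) ≤ packingEntropy (incoherentFrames n r b) dTwoInfty δ := by
  have : NeZero q := ⟨hq.ne'⟩
  obtain ⟨S, hS, hsep, hcard⟩ := exists_separated_orthonormal_families
    (E := EuclideanSpace ℝ (Fin (2 * r))) (r := r) (Fin q) hr.ne' (by simp [two_mul])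
  obtain ⟨w, hw⟩ : S.Nonempty :=
    Finset.card_pos.1 (by exact_mod_cast (Real.exp_pos _).trans_le hcard)
  have hu₀ : Orthonormal ℝ (w 0) := hS w hw 0
  obtain ⟨e⟩ : Nonempty ((Fin q ⊕ Fin q) × Fin (2 * r) ↪ Fin n) := by
    rw [Function.Embedding.nonempty_iff_card_le]
    simp only [Fintype.card_prod, Fintype.card_sum, Fintype.card_fin]
    linarith
  have hdist : (S : Set (Fin q → Fin r → EuclideanSpace ℝ (Fin (2 * r)))).Pairwise fun u v =>
      δ < dTwoInfty (anchoredFrame e (w 0) u) (anchoredFrame e (w 0) v) := fun u hu v hv huv => by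
    refine lt_of_lt_of_le ?_
      (sqrt_sum_norm_sub_sq_div_le_dTwoInfty_anchoredFrame hu₀ (hS u hu))
    have hlt := hsep hv hu huv.symm
    simp only [Fintype.card_fin] at hlt ⊢
    rw [Real.lt_sqrt hδ₀, lt_div_iff₀ (by positivity)]
    calc δ ^ 2 * (8 * q ^ 2 * (2 * r : ℕ)) = (r * q / 8 : ℝ) * (128 * q * δ ^ 2) := by
          push_cast
          ring
      _ ≤ (r * q / 8 : ℝ) * 1 := by gcongr
      _ < _ := by rwa [mul_one]
  refine le_packingEntropy (k := S.card) ?_ ?_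
  · refine hcard.trans_eq' ?_
    rw [Fintype.card_fin]
    push_cast
    ring_nf
  · rw [← Set.encard_coe_eq_coe_finsetCard]
    exact encard_le_packingNumber
      (fun u hu => anchoredFrame_mem_incoherentFrames hu₀ (hS u hu) (by simpa using hb))
      (fun U _ => (dTwoInfty_self U).trans_le hδ₀) hdist

theorem lemma4_general (hr : 0 < r) (hδ : 0 < δ) (hδ₁ : 16 * δ ≤ 1) (hb : 16 * δ ≤ b)
    (hn : r ≤ 64 * n * δ ^ 2) :
    ((1 / 4096 * (r ^ 2 / δ ^ 2) : ℝ) : EReal) ≤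
      packingEntropy (incoherentFrames n r b) dTwoInfty δ := by
  set t : ℝ := 1 / (256 * δ ^ 2) with ht
  have htδ : t * (256 * δ ^ 2) = 1 := div_mul_cancel₀ _ (by positivity)
  have ht₁ : 1 ≤ t := by
    rw [ht, le_div_iff₀ (by positivity)]
    nlinarith
  have hq : 0 < ⌊t⌋₊ := Nat.floor_pos.2 ht₁
  have hqt : (⌊t⌋₊ : ℝ) ≤ t := Nat.floor_le (by positivity)
  have htq : t ≤ 2 * ⌊t⌋₊ := by
    have hlt := Nat.lt_floor_add_one t
    have hone : (1 : ℝ) ≤ ⌊t⌋₊ := by exact_mod_cast hq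
    linarith
  have hrows : 4 * ⌊t⌋₊ * r ≤ n := by
    have : (4 * ⌊t⌋₊ * r : ℝ) ≤ n := calc
      (4 * ⌊t⌋₊ * r : ℝ) ≤ 4 * t * (64 * n * δ ^ 2) := by gcongr
      _ = n := by linear_combination (n : ℝ) * htδ
    exact_mod_cast this
  have hrow : (√(2 * ⌊t⌋₊ : ℝ))⁻¹ ≤ b := hb.trans' <| by
    have hsqrt : (16 * δ)⁻¹ ≤ √(2 * ⌊t⌋₊ : ℝ) := Real.le_sqrt_of_sq_le <| by
      calc (16 * δ)⁻¹ ^ 2 = t := by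
            rw [ht]
            field_simp
            norm_num
        _ ≤ _ := htq
    exact inv_le_of_inv_le₀ (by positivity) hsqrt
  have hsep : 128 * ⌊t⌋₊ * δ ^ 2 < 1 := by
    have : ⌊t⌋₊ * δ ^ 2 ≤ t * δ ^ 2 := by gcongr
    linarith
  calc ((1 / 4096 * (r ^ 2 / δ ^ 2) : ℝ) : EReal) ≤ ((⌊t⌋₊ * r ^ 2 / 8 : ℝ) : EReal) := by
        rw [EReal.coe_le_coe_iff]
        calc (1 / 4096 * (r ^ 2 / δ ^ 2) : ℝ) = t / 2 * r ^ 2 / 8 := by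
              rw [ht]
              field_simp
              norm_num
          _ ≤ (⌊t⌋₊ * r ^ 2 / 8 : ℝ) := by gcongr; linarith
    _ ≤ _ := mul_sq_div_eight_le_packingEntropy hq hr hrows hrow hδ.le hsep

end Entropy

theorem natCast_le_mul_sq_of_div_le {n r : ℕ} {δ : ℝ} (hn : 0 < n)
    (hδ : r / (8 * exp 1 ^ 2 * n) ≤ δ ^ 2) : r ≤ 64 * n * δ ^ 2 := by
  have he : exp 1 ^ 2 ≤ 8 := by nlinarith [Real.exp_one_lt_d9, Real.exp_pos 1]
  calc (r : ℝ) ≤ δ ^ 2 * (8 * exp 1 ^ 2 * n) := (div_le_iff₀ (by positivity)).1 hδ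
    _ ≤ δ ^ 2 * (8 * 8 * n) := by gcongr
    _ = 64 * n * δ ^ 2 := by ring

theorem one_le_log_of_four_le_div {x y : ℝ} (h : 4 ≤ x / y) : 1 ≤ Real.log (12 * x / y) := by
  rw [mul_div_assoc, Real.le_log_iff_exp_le (by linarith)]
  linarith [Real.exp_one_lt_d9]

theorem sixteen_mul_le_sqrt_of_sq_le {n r : ℕ} {μ δ L : ℝ} (hn : 0 < n) (hμ : 0 ≤ μ) (hL : 1 ≤ L)
    (hδ : δ ^ 2 ≤ μ * r / (96 * exp 1 ^ 2 * n * L)) :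
    16 * δ ≤ √(μ * r / n) := by
  have he : 4 ≤ exp 1 ^ 2 := by nlinarith [Real.exp_one_gt_d9]
  have hden : 256 * (n : ℝ) ≤ 96 * exp 1 ^ 2 * n * L :=
    calc 256 * (n : ℝ) ≤ 96 * 4 * n * 1 := by linarith [n.cast_nonneg (α := ℝ)]
      _ ≤ 96 * exp 1 ^ 2 * n * L := by gcongr
  refine Real.le_sqrt_of_sq_le ?_
  calc (16 * δ) ^ 2 = 256 * δ ^ 2 := by ring
    _ ≤ 256 * (μ * r / (256 * n)) := by
        gcongr
        exact hδ.trans (by gcongr)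
    _ = μ * r / n := by ring

theorem sqrt_mul_div_le_one {n r : ℕ} {μ : ℝ} (hμ : 0 < μ) (h : r ≤ n / μ) :
    √(μ * r / n) ≤ 1 :=
  Real.sqrt_le_one.2 <| div_le_one_of_le₀ (by rwa [le_div_iff₀' hμ] at h) n.cast_nonneg

theorem lemma4 :
    ∃ c₀ : ℝ, 0 < c₀ ∧ ∃ c : ℝ, 0 < c ∧ ∃ N : ℕ,
      ∀ n : ℕ, N ≤ n → ∀ r : ℕ, 1 ≤ r → r ≤ n → ∀ μ δ : ℝ,
        max 4 (r : ℝ) ≤ (n : ℝ) / μ →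
        12 * Real.log (12 * (n : ℝ)) ≤ μ →
        0 < δ →
        c₀ ^ 2 * (r : ℝ) / (8 * Real.exp 1 ^ 2 * (n : ℝ)) ≤ δ ^ 2 →
        δ ^ 2 ≤ c₀ ^ 2 * μ * (r : ℝ) /
          (96 * Real.exp 1 ^ 2 * (n : ℝ) * Real.log (12 * (n : ℝ) / μ)) →
        ((c * ((r : ℝ) ^ 2 / δ ^ 2) : ℝ) : EReal) ≤
          packingEntropy (incoherentFrames n r (Real.sqrt (μ * (r : ℝ) / (n : ℝ)))) dTwoInfty δ := by
  refine ⟨1, one_pos, 1 / 4096, by norm_num, 0, fun n _ r hr _ μ δ hmax _ hδ hlow hup => ?_⟩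
  obtain ⟨h4, hrμ⟩ := max_le_iff.1 hmax
  obtain ⟨hn, hμ⟩ : 0 < (n : ℝ) ∧ 0 < μ :=
    (div_pos_iff.1 (four_pos.trans_le h4)).resolve_right fun h => h.1.not_ge n.cast_nonneg
  rw [Nat.cast_pos] at hn
  rw [one_pow, one_mul] at hlow hup
  have hb := sixteen_mul_le_sqrt_of_sq_le hn hμ.le (one_le_log_of_four_le_div h4) hup
  exact lemma4_general hr hδ (hb.trans (sqrt_mul_div_le_one hμ hrμ)) hb
    (natCast_le_mul_sq_of_div_le hn hlow)
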